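/- Let $\sigma=\mathrm{Prop}\cup\{R_i\mid i\in I\}$ be a modal signature with a finite set $\mathrm{Prop}$ of unary proposition letters and binary actions $R_i$ indexed by a finite set $I$. A $\sigma$-LTS $M_a$ is a (possibly infinite) $\sigma$-structure $M$ with a distinguished state $a$; it is degree-finite if every state has only finitely many successors and finitely many predecessors along the actions. A homomorphism of $\sigma$-LTSs is a map of states that preserves the distinguished state, the proposition letters and the actions; $\hom_{\mathbb N}(T_c,M_a)\in\mathbb N$ is the number of homomorphisms from $T_c$ to $M_a$, when this is finite. A $\sigma$-path of length $\ell\ge 0$ from $s_0$ to $s_\ell$ consists of states $s_0,\dots,s_\ell$ and binary facts $f_1,\dots,f_\ell$, where each $f_j$ is of the form $R_i(s_{j-1},s_j)$ or $R_i(s_j,s_{j-1})$ for some $i\in I$. A $\sigma$-LTS is connected if there is a $\sigma$-path between any two states, and acyclic if there is no $\sigma$-path of positive length from a state to itself in which no binary fact is repeated. The depth of a connected $\sigma$-LTS is the supremum, over its states $m$, of the length of a shortest $\sigma$-path from the distinguished state to $m$. Let $\mathcal A^k_\sigma$ be the class of finite connected acyclic $\sigma$-LTSs of depth at most $k$. Formulas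 of graded modal logic with graded backward modalities are given by $$\varphi ::= \top\mid p\mid\varphi\wedge\varphi\mid\varphi\vee\varphi\mid\neg\varphi\mid\Diamond_i\varphi\mid\Box_i\varphi\mid\Diamond_i^{\ge n}\varphi\ (n\ge 1)\mid\blacklozenge_i^{\ge n}\varphi\ (n\in\mathbb N),$$ with $p\in\mathrm{Prop}$ and $i\in I$, where $\Diamond_i,\Box_i$ have their usual semantics, and $\Diamond_i^{\ge n}\varphi$ (resp. $\blacklozenge_i^{\ge n}\varphi$) holds at a state if at least $n$ of its $R_i$-successors (resp. $R_i$-predecessors) satisfy $\varphi$. The modal depth of a formula is its maximal nesting of modalities, forward and backward. **Theorem.** Let $M_a$ and $N_b$ be degree-finite $\sigma$-LTSs and let $k\in\mathbb N$. Then for every $T_c\in\mathcal A^k_\sigma$ there are only finitely many homomorphisms from $T_c$ to $M_a$ and from $T_c$ to $N_b$, and the following are equivalent: 1. $\hom_{\mathbb N}(T_c,M_a)=\hom_{\mathbb N}(T_c,N_b)$ for all $T_c\in\mathcal A^k_\sigma$; 2. $M_a$ and $N_b$ satisfy the same formulas of graded modal logic with graded backward modalities of modal depth at most $k$. -/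

import Mathlib

universe uP uI u v w

namespace ModalHom

/-- A labeled transition system over the modal signature with proposition letters `P` and
actions indexed by `I`: a relational structure with one distinguished state. -/
structure LTS (P : Type uP) (I : Type uI) where
  State : Type u
  val : P → State → Prop
  rel : I → State → State → Prop
  point : State

variable {P : Type uP} {I : Type uI}

namespace LTS

/-- The states reachable from `m` by one transition. -/
def succ (M : LTS.{uP, uI, u} P I) (m : M.State) : Set M.State := {n | ∃ i, M.rel i m n}

/-- The states from which `m` is reachable by one transition. -/
def pred (M : LTS.{uP, uI, u} P I) (m : M.State) : Set M.State := {n | ∃ i, M.rel i n m}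

def DegreeFinite (M : LTS.{uP, uI, u} P I) : Prop :=
  ∀ m : M.State, (M.succ m).Finite ∧ (M.pred m).Finite

/-- Homomorphisms of labeled transition systems. -/
@[ext]
structure Hom (M : LTS.{uP, uI, u} P I) (N : LTS.{uP, uI, v} P I) where
  toFun : M.State → N.State
  map_point : toFun M.point = N.point
  map_val : ∀ p m, M.val p m → N.val p (toFun m)
  map_rel : ∀ i m n, M.rel i m n → N.rel i (toFun m) (toFun n)

/-- The homomorphism count over the natural number semiring. It is meaningful
when there are finitely many homomorphisms. -/
noncomputable def homCount (M : LTS.{uP, uI, u} P I) (N : LTS.{uP, uI, v} P I) : ℕ :=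
  Nat.card (Hom M N)

/-- The left homomorphism vector of `M` restricted to the class `C`. -/
noncomputable def leftProfile (C : Set (LTS.{uP, uI, u} P I)) (M : LTS.{uP, uI, v} P I) :
    C → ℕ :=
  fun T => homCount T.1 M

/-- The binary facts `R_i(src, tgt)` of `M`. -/
structure Fact (M : LTS.{uP, uI, u} P I) where
  label : I
  src : M.State
  tgt : M.State
  holds : M.rel label src tgt

/-- `M.IsPath x y l`: the list `l` of binary facts is an undirected path from `x` to `y`.
Consecutive states along the path are the two ends of the corresponding fact,
which may be traversed in either direction. -/
inductive IsPath (M : LTS.{uP, uI, u} P I) : M.State → M.State → List M.Fact → Prop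
  | nil (x : M.State) : IsPath M x x []
  | cons {x y z : M.State} {l : List M.Fact} (f : M.Fact)
      (hf : (f.src = x ∧ f.tgt = y) ∨ (f.src = y ∧ f.tgt = x)) (h : IsPath M y z l) :
      IsPath M x z (f :: l)

def Connected (M : LTS.{uP, uI, u} P I) : Prop :=
  ∀ x y : M.State, ∃ l, M.IsPath x y l

/-- There is no path of positive length from a state to itself without duplicate facts. -/
def Acyclic (M : LTS.{uP, uI, u} P I) : Prop :=
  ∀ (x : M.State) (l : List M.Fact), M.IsPath x x l → l.Nodup → l = []

/-- The length of a shortest undirected path from the distinguished state to `m`. -/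
noncomputable def stateDepth (M : LTS.{uP, uI, u} P I) (m : M.State) : ℕ∞ :=
  ⨅ (l : List M.Fact) (_ : M.IsPath M.point m l), (l.length : ℕ∞)

noncomputable def depth (M : LTS.{uP, uI, u} P I) : ℕ∞ :=
  ⨆ m : M.State, M.stateDepth m

variable (P I) in
/-- The class of finite connected acyclic labeled transition systems of depth at most `k`. -/
def connectedAcyclic (k : ℕ) : Set (LTS.{uP, uI, u} P I) :=
  {T | Finite T.State ∧ T.Connected ∧ T.Acyclic ∧ T.depth ≤ k}

end LTS

variable (P I) in
/-- Formulas of graded modal logic with graded backward modalities. -/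
inductive Formula : Type max uP uI
  | top : Formula
  | letter (p : P) : Formula
  | and (φ ψ : Formula) : Formula
  | or (φ ψ : Formula) : Formula
  | not (φ : Formula) : Formula
  | dia (i : I) (φ : Formula) : Formula
  | box (i : I) (φ : Formula) : Formula
  | diaGe (i : I) (n : ℕ+) (φ : Formula) : Formula
  | backGe (i : I) (n : ℕ) (φ : Formula) : Formula

namespace Formula

/-- The maximal nesting of (forward and backward) modalities. -/
def modalDepth : Formula P I → ℕ
  | top => 0
  | letter _ => 0
  | and φ ψ => max φ.modalDepth ψ.modalDepth
  | or φ ψ => max φ.modalDepth ψ.modalDepth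
  | not φ => φ.modalDepth
  | dia _ φ => φ.modalDepth + 1
  | box _ φ => φ.modalDepth + 1
  | diaGe _ _ φ => φ.modalDepth + 1
  | backGe _ _ φ => φ.modalDepth + 1

/-- Satisfaction of a formula at a state of `M`. -/
def SatAt (M : LTS.{uP, uI, u} P I) : Formula P I → M.State → Prop
  | top, _ => True
  | letter p, m => M.val p m
  | and φ ψ, m => φ.SatAt M m ∧ ψ.SatAt M m
  | or φ ψ, m => φ.SatAt M m ∨ ψ.SatAt M m
  | not φ, m => ¬ φ.SatAt M m
  | dia i φ, m => ∃ n, M.rel i m n ∧ φ.SatAt M n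
  | box i φ, m => ∀ n, M.rel i m n → φ.SatAt M n
  | diaGe i k φ, m => ((k : ℕ) : ℕ∞) ≤ {n | M.rel i m n ∧ φ.SatAt M n}.encard
  | backGe i k φ, m => (k : ℕ∞) ≤ {n | M.rel i n m ∧ φ.SatAt M n}.encard

end Formula

namespace LTS

/-- `M` satisfies `φ` at its distinguished state. -/
def Sat (M : LTS.{uP, uI, u} P I) (φ : Formula P I) : Prop := φ.SatAt M M.point

/-- `M` and `N` satisfy the same formulas of modal depth at most `k`. -/
def ModalEquiv (k : ℕ) (M : LTS.{uP, uI, u} P I) (N : LTS.{uP, uI, v} P I) : Prop :=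
  ∀ φ : Formula P I, φ.modalDepth ≤ k → (M.Sat φ ↔ N.Sat φ)

end LTS

end ModalHom

/-! A finite connected acyclic system is a tree rooted at its distinguished state, built by
repeatedly attaching smaller trees to a root by one edge (`exists_tree_represents`; conversely
`exists_represents`). Attaching `t'` along `j` multiplies the number of homomorphisms sending the
root to `m` by the sum of the counts of `t'` over the `j`-neighbours of `m`. Graded modalities
likewise determine sums over neighbours, namely those of indicators of formulas.

The two kinds of sums are compared by `finsum_mem_eq_of_submonoid`. Counts of trees of depth at most
`k` are closed under products (glue the roots), and so are indicators of formulas of modal depth at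
most `k` (take conjunctions). Each state is thus a multiplicative character of the family, and
distinct characters are linearly independent. Hence if all sums over two finite neighbourhoods
agree, each class of indistinguishable states occurs equally often in both, and the sums of every
function constant on classes agree. Inductions on formulas and on trees then give the two
implications (`satAt_iff_of_count_eq`, `count_eq_of_satAt_iff`). -/

namespace ModalHom

/-! ### Linear independence of characters -/

/-- Two finite sums of values agree for every function that only depends on the values of the
members of a multiplicative family, as soon as they agree for the members of the family. -/
theorem finsum_mem_eq_of_submonoid {W : Type*} (G : Submonoid (W → ℕ)) {s t : Set W}
    (hs : s.Finite) (ht : t.Finite)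
    (h : ∀ g ∈ G, ∑ᶠ x ∈ s, g x = ∑ᶠ x ∈ t, g x) {f : W → ℕ}
    (hf : ∀ x y, (∀ g ∈ G, g x = g y) → f x = f y) :
    ∑ᶠ x ∈ s, f x = ∑ᶠ x ∈ t, f x := by
  classical
  simp only [finsum_mem_eq_finite_toFinset_sum _ hs, finsum_mem_eq_finite_toFinset_sum _ ht] at h ⊢
  generalize hs.toFinset = s at h ⊢
  generalize ht.toFinset = t at h ⊢
  let ev : W → (G →* ℚ) := fun x =>
    { toFun := fun g => ((g : W → ℕ) x : ℚ)
      map_one' := by simp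
      map_mul' := by simp }
  have hev : ∀ x y, ev x = ev y → f x = f y := fun x y hxy => hf x y fun g hg => by
    have : (g x : ℚ) = g y := DFunLike.congr_fun hxy ⟨g, hg⟩
    exact_mod_cast this
  have hind := linearIndependent_monoidHom G ℚ
  -- By independence of characters, equality of the sums as functions on `G` lifts to equality of
  -- formal sums: every character has the same multiplicity in `s` and in `t`.
  have hc : (∑ x ∈ s, Finsupp.single (ev x) (1 : ℚ)) = ∑ x ∈ t, Finsupp.single (ev x) (1 : ℚ) := by
    apply hind
    simp only [map_sum, Finsupp.linearCombination_single, one_smul]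
    ext g
    simp only [Finset.sum_apply]
    have := h g.1 g.2
    change ∑ x ∈ s, ((g : W → ℕ) x : ℚ) = ∑ x ∈ t, ((g : W → ℕ) x : ℚ)
    exact_mod_cast this
  -- `f` descends to characters. The default 0 is harmless, since `F` is only evaluated at
  -- characters of the form `ev x`.
  let F : (G →* ℚ) → ℚ := fun c => if hx : ∃ x, ev x = c then (f hx.choose : ℚ) else 0
  have hF : ∀ x, F (ev x) = f x := fun x => by
    have hx : ∃ y, ev y = ev x := ⟨x, rfl⟩
    simp only [F, dif_pos hx]
    exact_mod_cast hev _ _ hx.choose_spec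
  have := congrArg (Finsupp.linearCombination ℚ F) hc
  simp only [map_sum, Finsupp.linearCombination_single, one_smul, hF] at this
  exact_mod_cast this

variable {P : Type uP} {I : Type uI}

/-! ### Neighbourhoods and generated embeddings -/

namespace LTS

/-- The states adjacent to `m` by an action traversed forward (`true`) or backward (`false`). -/
def step (M : LTS.{uP, uI, u} P I) : I × Bool → M.State → Set M.State
  | (i, true), m => {n | M.rel i m n}
  | (i, false), m => {n | M.rel i n m}

theorem DegreeFinite.finite_step {M : LTS.{uP, uI, u} P I} (hM : M.DegreeFinite)
    (j : I × Bool) (m : M.State) : (M.step j m).Finite := by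
  obtain ⟨i, _ | _⟩ := j
  · exact (hM m).2.subset fun n hn => ⟨i, hn⟩
  · exact (hM m).1.subset fun n hn => ⟨i, hn⟩

/-- The system `M` with distinguished state `m`. -/
def withPoint (M : LTS.{uP, uI, u} P I) (m : M.State) : LTS.{uP, uI, u} P I :=
  { M with point := m }

/-- The disjoint union of two systems. -/
def disjUnion (M : LTS.{uP, uI, u} P I) (N : LTS.{uP, uI, v} P I) : LTS.{uP, uI, max u v} P I where
  State := M.State ⊕ N.State
  val p := Sum.elim (M.val p) (N.val p)
  rel i := Sum.LiftRel (M.rel i) (N.rel i)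
  point := Sum.inl M.point

/-- An injective map that identifies a system with a subsystem that is closed under the actions
and their converses. -/
structure IsGeneratedEmbedding (M : LTS.{uP, uI, u} P I) (N : LTS.{uP, uI, v} P I)
    (e : M.State → N.State) : Prop where
  injective : Function.Injective e
  val_iff (p : P) (m : M.State) : N.val p (e m) ↔ M.val p m
  step_eq (j : I × Bool) (m : M.State) : N.step j (e m) = e '' M.step j m

theorem isGeneratedEmbedding_inl (M : LTS.{uP, uI, u} P I) (N : LTS.{uP, uI, v} P I) :
    IsGeneratedEmbedding M (M.disjUnion N) Sum.inl where
  injective := Sum.inl_injective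
  val_iff _ _ := Iff.rfl
  step_eq := by
    rintro ⟨i, _ | _⟩ m
    · refine Set.ext fun x => ⟨?_, ?_⟩
      · rintro (h : Sum.LiftRel (M.rel i) (N.rel i) x (Sum.inl m))
        cases h with
        | inl h => exact ⟨_, h, rfl⟩
      · rintro ⟨y, hy, rfl⟩
        exact Sum.LiftRel.inl hy
    · refine Set.ext fun x => ⟨?_, ?_⟩
      · rintro (h : Sum.LiftRel (M.rel i) (N.rel i) (Sum.inl m) x)
        cases h with
        | inl h => exact ⟨_, h, rfl⟩
      · rintro ⟨y, hy, rfl⟩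
        exact Sum.LiftRel.inl hy

theorem isGeneratedEmbedding_inr (M : LTS.{uP, uI, u} P I) (N : LTS.{uP, uI, v} P I) :
    IsGeneratedEmbedding N (M.disjUnion N) Sum.inr where
  injective := Sum.inr_injective
  val_iff _ _ := Iff.rfl
  step_eq := by
    rintro ⟨i, _ | _⟩ m
    · refine Set.ext fun x => ⟨?_, ?_⟩
      · rintro (h : Sum.LiftRel (M.rel i) (N.rel i) x (Sum.inr m))
        cases h with
        | inr h => exact ⟨_, h, rfl⟩
      · rintro ⟨y, hy, rfl⟩
        exact Sum.LiftRel.inr hy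
    · refine Set.ext fun x => ⟨?_, ?_⟩
      · rintro (h : Sum.LiftRel (M.rel i) (N.rel i) (Sum.inr m) x)
        cases h with
        | inr h => exact ⟨_, h, rfl⟩
      · rintro ⟨y, hy, rfl⟩
        exact Sum.LiftRel.inr hy

end LTS

/-! ### Trees and their homomorphism counts -/

variable (P I) in
/-- Finite rooted trees: a single node with a set of letters, or a tree with a further tree
attached to its root by an edge. -/
inductive Tree : Type max uP uI
  | leaf (S : Set P) : Tree
  | graft (t : Tree) (j : I × Bool) (t' : Tree) : Tree

namespace Tree

def depth : Tree P I → ℕ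
  | leaf _ => 0
  | graft t _ t' => max t.depth (t'.depth + 1)

open Classical in
/-- The number of homomorphisms of a tree that send the root to `m`. -/
noncomputable def count (M : LTS.{uP, uI, u} P I) : Tree P I → M.State → ℕ
  | leaf S, m => if ∀ p ∈ S, M.val p m then 1 else 0
  | graft t j t', m => t.count M m * ∑ᶠ n ∈ M.step j m, t'.count M n

/-- Add letters to the root. -/
def addLetters (S : Set P) : Tree P I → Tree P I
  | leaf S' => leaf (S ∪ S')
  | graft t j t' => graft (t.addLetters S) j t'

/-- Glue two trees at their roots. -/
def glue (t : Tree P I) : Tree P I → Tree P I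
  | leaf S => t.addLetters S
  | graft t₁ j t' => graft (t.glue t₁) j t'

theorem depth_addLetters (S : Set P) (t : Tree P I) : (t.addLetters S).depth = t.depth := by
  induction t with
  | leaf _ => rfl
  | graft t j t' ih _ => simp [addLetters, depth, ih]

theorem depth_glue (t t' : Tree P I) : (t.glue t').depth = max t.depth t'.depth := by
  induction t' with
  | leaf S => simp [glue, depth, depth_addLetters]
  | graft t₁ j t' ih _ => simp [glue, depth, ih, max_assoc]

theorem count_addLetters (M : LTS.{uP, uI, u} P I) (S : Set P) (t : Tree P I) (m : M.State) :
    (t.addLetters S).count M m = t.count M m * (leaf S : Tree P I).count M m := by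
  classical
  induction t with
  | leaf S' =>
    simp only [addLetters, count, Set.mem_union, or_imp, forall_and]
    by_cases h : ∀ p ∈ S, M.val p m
    · rw [if_pos h, mul_one]
      exact if_congr (and_iff_right h) rfl rfl
    · simp only [h, false_and, if_false, mul_zero]
  | graft t j t' ih _ => simp only [addLetters, count, ih]; ring

/-- Once the image of the common root is fixed, the two trees are mapped independently. This makes
the counting functions a multiplicative family. -/
theorem count_glue (M : LTS.{uP, uI, u} P I) (t t' : Tree P I) (m : M.State) :
    (t.glue t').count M m = t.count M m * t'.count M m := by
  induction t' with
  | leaf S => exact count_addLetters M S t m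
  | graft t₁ j t' ih _ => simp only [glue, count, ih]; ring

theorem count_apply_embedding {M : LTS.{uP, uI, u} P I} {N : LTS.{uP, uI, v} P I}
    {e : M.State → N.State} (he : LTS.IsGeneratedEmbedding M N e) (t : Tree P I) (m : M.State) :
    t.count N (e m) = t.count M m := by
  classical
  induction t generalizing m with
  | leaf S => exact if_congr (forall₂_congr fun p _ => he.val_iff p m) rfl rfl
  | graft t j t' ih ih' =>
    simp only [count, ih, he.step_eq]
    rw [finsum_mem_image he.injective.injOn]
    simp only [ih']

/-- The counting functions of the trees of depth at most `k`. -/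
noncomputable def countSubmonoid (M : LTS.{uP, uI, u} P I) (k : ℕ) : Submonoid (M.State → ℕ) where
  carrier := {g | ∃ t : Tree P I, t.depth ≤ k ∧ t.count M = g}
  one_mem' := ⟨leaf ∅, Nat.zero_le k, by ext m; simp [count]⟩
  mul_mem' := by
    rintro _ _ ⟨t, ht, rfl⟩ ⟨t', ht', rfl⟩
    exact ⟨t.glue t', by simp [depth_glue, ht, ht'], by ext m; simp [count_glue]⟩

end Tree

/-! ### Formulas and their indicator functions -/

namespace Formula

theorem satAt_apply_embedding {M : LTS.{uP, uI, u} P I} {N : LTS.{uP, uI, v} P I}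
    {e : M.State → N.State} (he : LTS.IsGeneratedEmbedding M N e) (φ : Formula P I) (m : M.State) :
    φ.SatAt N (e m) ↔ φ.SatAt M m := by
  have hs : ∀ (j : I × Bool) (m : M.State) (φ : Formula P I),
      (∀ m, φ.SatAt N (e m) ↔ φ.SatAt M m) →
      {n | n ∈ N.step j (e m) ∧ φ.SatAt N n} = e '' {n | n ∈ M.step j m ∧ φ.SatAt M n} := by
    intro j m φ h
    rw [he.step_eq]
    ext x
    constructor
    · rintro ⟨⟨y, hy, rfl⟩, hx⟩
      exact ⟨y, ⟨hy, (h y).1 hx⟩, rfl⟩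
    · rintro ⟨y, ⟨hy, hx⟩, rfl⟩
      exact ⟨⟨y, hy, rfl⟩, (h y).2 hx⟩
  induction φ generalizing m with
  | top => rfl
  | letter p => exact he.val_iff p m
  | and φ ψ h h' => exact and_congr (h m) (h' m)
  | or φ ψ h h' => exact or_congr (h m) (h' m)
  | not φ h => exact not_congr (h m)
  | dia i φ h =>
    change {n | n ∈ N.step (i, true) (e m) ∧ φ.SatAt N n}.Nonempty ↔ _
    rw [hs _ _ _ h, Set.image_nonempty]
    rfl
  | box i φ h =>
    change (∀ n ∈ N.step (i, true) (e m), φ.SatAt N n) ↔ _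
    rw [he.step_eq, Set.forall_mem_image]
    exact forall₂_congr fun n _ => h n
  | diaGe i n φ h =>
    change _ ≤ {n | n ∈ N.step (i, true) (e m) ∧ φ.SatAt N n}.encard ↔ _
    rw [hs _ _ _ h, he.injective.encard_image]
    rfl
  | backGe i n φ h =>
    change _ ≤ {n | n ∈ N.step (i, false) (e m) ∧ φ.SatAt N n}.encard ↔ _
    rw [hs _ _ _ h, he.injective.encard_image]
    rfl

open Classical in
/-- The indicator function of the set of states that satisfy a formula. -/
noncomputable def indicator (M : LTS.{uP, uI, u} P I) (φ : Formula P I) (m : M.State) : ℕ :=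
  if φ.SatAt M m then 1 else 0

theorem indicator_eq_iff {M : LTS.{uP, uI, u} P I} {φ : Formula P I} {m n : M.State} :
    φ.indicator M m = φ.indicator M n ↔ (φ.SatAt M m ↔ φ.SatAt M n) := by
  unfold indicator
  split_ifs <;> simp_all

/-- The indicator functions of the formulas of modal depth at most `k`. -/
noncomputable def indicatorSubmonoid (M : LTS.{uP, uI, u} P I) (k : ℕ) :
    Submonoid (M.State → ℕ) where
  carrier := {g | ∃ φ : Formula P I, φ.modalDepth ≤ k ∧ φ.indicator M = g}
  one_mem' := ⟨top, Nat.zero_le k, by ext m; simp [indicator, SatAt]⟩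
  mul_mem' := by
    rintro _ _ ⟨φ, hφ, rfl⟩ ⟨ψ, hψ, rfl⟩
    refine ⟨φ.and ψ, max_le hφ hψ, ?_⟩
    ext m
    simp only [indicator, SatAt, Pi.mul_apply]
    classical
    by_cases h : φ.SatAt M m <;> simp [h]

theorem encard_eq_finsum_indicator {M : LTS.{uP, uI, u} P I} (φ : Formula P I) {s : Set M.State}
    (hs : s.Finite) :
    {n | n ∈ s ∧ φ.SatAt M n}.encard = ((∑ᶠ n ∈ s, φ.indicator M n : ℕ) : ℕ∞) := by
  classical
  rw [finsum_mem_eq_finite_toFinset_sum _ hs]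
  simp only [indicator]
  rw [Finset.sum_boole, Nat.cast_id, ← Set.encard_coe_eq_coe_finsetCard]
  congr 1
  ext
  simp

theorem satAt_diaGe_iff {M : LTS.{uP, uI, u} P I} (hM : M.DegreeFinite) {i : I} {k : ℕ+}
    {φ : Formula P I} {m : M.State} :
    (diaGe i k φ).SatAt M m ↔ k ≤ ∑ᶠ n ∈ M.step (i, true) m, φ.indicator M n := by
  rw [← Nat.cast_le (α := ℕ∞), ← encard_eq_finsum_indicator φ (hM.finite_step _ _)]
  rfl

theorem satAt_backGe_iff {M : LTS.{uP, uI, u} P I} (hM : M.DegreeFinite) {i : I} {k : ℕ}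
    {φ : Formula P I} {m : M.State} :
    (backGe i k φ).SatAt M m ↔ k ≤ ∑ᶠ n ∈ M.step (i, false) m, φ.indicator M n := by
  rw [← Nat.cast_le (α := ℕ∞), ← encard_eq_finsum_indicator φ (hM.finite_step _ _)]
  rfl

theorem satAt_dia_iff {M : LTS.{uP, uI, u} P I} {i : I} {φ : Formula P I} {m : M.State} :
    (dia i φ).SatAt M m ↔ (diaGe i 1 φ).SatAt M m := by
  simp only [SatAt, PNat.one_coe, Nat.cast_one, Set.one_le_encard_iff_nonempty]
  rfl

theorem satAt_box_iff {M : LTS.{uP, uI, u} P I} {i : I} {φ : Formula P I} {m : M.State} :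
    (box i φ).SatAt M m ↔ ¬ (dia i φ.not).SatAt M m := by
  simp [SatAt]

end Formula

/-! ### Equivalence for trees versus equivalence for formulas -/

theorem finsum_step_eq_of_count_eq {M : LTS.{uP, uI, u} P I} (hM : M.DegreeFinite) {k : ℕ}
    {m n : M.State} (h : ∀ t : Tree P I, t.depth ≤ k + 1 → t.count M m = t.count M n)
    {f : M.State → ℕ}
    (hf : ∀ x y, (∀ t : Tree P I, t.depth ≤ k → t.count M x = t.count M y) → f x = f y)
    (j : I × Bool) : ∑ᶠ x ∈ M.step j m, f x = ∑ᶠ x ∈ M.step j n, f x := by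
  refine finsum_mem_eq_of_submonoid (Tree.countSubmonoid M k) (hM.finite_step j m)
    (hM.finite_step j n) ?_ fun x y hxy => hf x y fun t ht => hxy _ ⟨t, ht, rfl⟩
  rintro _ ⟨t, ht, rfl⟩
  -- Hanging `t` below an unlabelled root gives a tree of depth at most `k + 1` whose count is
  -- exactly the sum over the neighbours.
  simpa [Tree.count] using h (.graft (.leaf ∅) j t) (by simpa [Tree.depth] using ht)

/-- The sum of an indicator over the neighbours is the number of neighbours satisfying the formula,
and a natural number is determined by the thresholds it reaches, each expressed by one graded
modality. -/
theorem finsum_step_eq_of_satAt_iff {M : LTS.{uP, uI, u} P I} (hM : M.DegreeFinite) {k : ℕ}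
    {m n : M.State}
    (h : ∀ φ : Formula P I, φ.modalDepth ≤ k + 1 → (φ.SatAt M m ↔ φ.SatAt M n))
    {f : M.State → ℕ}
    (hf : ∀ x y, (∀ φ : Formula P I, φ.modalDepth ≤ k → (φ.SatAt M x ↔ φ.SatAt M y)) → f x = f y)
    (j : I × Bool) : ∑ᶠ x ∈ M.step j m, f x = ∑ᶠ x ∈ M.step j n, f x := by
  refine finsum_mem_eq_of_submonoid (Formula.indicatorSubmonoid M k) (hM.finite_step j m)
    (hM.finite_step j n) ?_
    fun x y hxy => hf x y fun φ hφ => Formula.indicator_eq_iff.1 (hxy _ ⟨φ, hφ, rfl⟩)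
  rintro _ ⟨φ, hφ, rfl⟩
  obtain ⟨i, _ | _⟩ := j
  · refine eq_of_forall_le_iff fun c => ?_
    rw [← Formula.satAt_backGe_iff hM, ← Formula.satAt_backGe_iff hM]
    exact h _ (Nat.succ_le_succ hφ)
  · refine eq_of_forall_le_iff fun c => ?_
    -- The forward modality has no threshold 0, but that threshold is always reached.
    obtain rfl | hc := Nat.eq_zero_or_pos c
    · simp
    · have := h (.diaGe i ⟨c, hc⟩ φ) (Nat.succ_le_succ hφ)
      exact (Formula.satAt_diaGe_iff hM).symm.trans (this.trans (Formula.satAt_diaGe_iff hM))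

theorem satAt_iff_of_count_eq {M : LTS.{uP, uI, u} P I} (hM : M.DegreeFinite) (φ : Formula P I)
    {k : ℕ} {m n : M.State} (hk : φ.modalDepth ≤ k)
    (h : ∀ t : Tree P I, t.depth ≤ k → t.count M m = t.count M n) :
    φ.SatAt M m ↔ φ.SatAt M n := by
  -- The induction hypothesis is an argument so that the claim also applies to `φ.not`, as the `box`
  -- case requires.
  have key : ∀ (φ : Formula P I) {k : ℕ}, φ.modalDepth + 1 ≤ k →
      (∀ {k : ℕ} {m n : M.State}, φ.modalDepth ≤ k →
        (∀ t : Tree P I, t.depth ≤ k → t.count M m = t.count M n) →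
        (φ.SatAt M m ↔ φ.SatAt M n)) →
      ∀ {m n : M.State}, (∀ t : Tree P I, t.depth ≤ k → t.count M m = t.count M n) →
      ∀ j, ∑ᶠ x ∈ M.step j m, φ.indicator M x = ∑ᶠ x ∈ M.step j n, φ.indicator M x := by
    intro φ k hk ih m n h j
    obtain ⟨k, rfl⟩ : ∃ l, k = l + 1 := ⟨k - 1, by omega⟩
    exact finsum_step_eq_of_count_eq hM h
      (fun x y hxy => Formula.indicator_eq_iff.2 (ih (by omega) hxy)) j
  induction φ generalizing k m n with
  | top => rfl
  | letter p =>
    have := h (.leaf {p}) (Nat.zero_le k)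
    simp only [Tree.count, Set.mem_singleton_iff, forall_eq] at this
    simp only [Formula.SatAt]
    split_ifs at this <;> simp_all
  | and φ ψ ih ih' =>
    exact and_congr (ih (le_trans (le_max_left _ _) hk) h) (ih' (le_trans (le_max_right _ _) hk) h)
  | or φ ψ ih ih' =>
    exact or_congr (ih (le_trans (le_max_left _ _) hk) h) (ih' (le_trans (le_max_right _ _) hk) h)
  | not φ ih => exact not_congr (ih hk h)
  | dia i φ ih =>
    rw [Formula.satAt_dia_iff, Formula.satAt_dia_iff, Formula.satAt_diaGe_iff hM,
      Formula.satAt_diaGe_iff hM, key φ hk ih h]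
  | box i φ ih =>
    rw [Formula.satAt_box_iff, Formula.satAt_box_iff, Formula.satAt_dia_iff, Formula.satAt_dia_iff,
      Formula.satAt_diaGe_iff hM, Formula.satAt_diaGe_iff hM,
      key φ.not hk (fun hk h => not_congr (ih hk h)) h]
  | diaGe i c φ ih =>
    rw [Formula.satAt_diaGe_iff hM, Formula.satAt_diaGe_iff hM, key φ hk ih h]
  | backGe i c φ ih =>
    rw [Formula.satAt_backGe_iff hM, Formula.satAt_backGe_iff hM, key φ hk ih h]

theorem count_eq_of_satAt_iff {M : LTS.{uP, uI, u} P I} (hM : M.DegreeFinite) (t : Tree P I)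
    {k : ℕ} {m n : M.State} (hk : t.depth ≤ k)
    (h : ∀ φ : Formula P I, φ.modalDepth ≤ k → (φ.SatAt M m ↔ φ.SatAt M n)) :
    t.count M m = t.count M n := by
  classical
  induction t generalizing k m n with
  | leaf S =>
    exact if_congr (forall₂_congr fun p _ => h (.letter p) (Nat.zero_le k)) rfl rfl
  | graft t j t' ih ih' =>
    have hk' : t'.depth + 1 ≤ k := (le_max_right _ _).trans hk
    simp only [Tree.count]
    rw [ih ((le_max_left _ _).trans hk) h]
    obtain ⟨k, rfl⟩ : ∃ l, k = l + 1 := ⟨k - 1, by omega⟩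
    rw [finsum_step_eq_of_satAt_iff hM h (fun x y hxy => ih' (by omega) hxy) j]

theorem LTS.DegreeFinite.disjUnion {M : LTS.{uP, uI, u} P I} {N : LTS.{uP, uI, v} P I}
    (hM : M.DegreeFinite) (hN : N.DegreeFinite) : (M.disjUnion N).DegreeFinite := by
  rintro (m | m)
  · refine ⟨((hM m).1.image Sum.inl).subset ?_, ((hM m).2.image Sum.inl).subset ?_⟩ <;>
      rintro (x | x) ⟨i, hi⟩ <;> simp_all [LTS.disjUnion, LTS.succ, LTS.pred] <;> exact ⟨i, hi⟩
  · refine ⟨((hN m).1.image Sum.inr).subset ?_, ((hN m).2.image Sum.inr).subset ?_⟩ <;>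
      rintro (x | x) ⟨i, hi⟩ <;> simp_all [LTS.disjUnion, LTS.succ, LTS.pred] <;> exact ⟨i, hi⟩

/-- The comparison lemmas concern two states of one system. Both systems embed in their disjoint
union without changing counts or satisfaction. -/
theorem forall_count_eq_iff_modalEquiv {M : LTS.{uP, uI, u} P I} {N : LTS.{uP, uI, v} P I}
    (hM : M.DegreeFinite) (hN : N.DegreeFinite) (k : ℕ) :
    (∀ t : Tree P I, t.depth ≤ k → t.count M M.point = t.count N N.point) ↔
      LTS.ModalEquiv k M N := by
  have hD := hM.disjUnion hN
  have hl := LTS.isGeneratedEmbedding_inl M N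
  have hr := LTS.isGeneratedEmbedding_inr M N
  constructor
  · intro h φ hφ
    rw [LTS.Sat, LTS.Sat, ← Formula.satAt_apply_embedding hl, ← Formula.satAt_apply_embedding hr]
    refine satAt_iff_of_count_eq hD φ hφ fun t ht => ?_
    rw [Tree.count_apply_embedding hl, Tree.count_apply_embedding hr, h t ht]
  · intro h t ht
    rw [← Tree.count_apply_embedding hl, ← Tree.count_apply_embedding hr]
    refine count_eq_of_satAt_iff hD t ht fun φ hφ => ?_
    rw [Formula.satAt_apply_embedding hl, Formula.satAt_apply_embedding hr]
    exact h φ hφ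

/-! ### Paths, acyclicity and depth -/

namespace LTS

theorem Fact.eq_of_eq {M : LTS.{uP, uI, u} P I} {f g : M.Fact} (hl : f.label = g.label)
    (hs : f.src = g.src) (ht : f.tgt = g.tgt) : f = g := by
  obtain ⟨i, x, y, h⟩ := f
  obtain ⟨i', x', y', h'⟩ := g
  obtain rfl : i = i' := hl
  obtain rfl : x = x' := hs
  obtain rfl : y = y' := ht
  rfl

section Paths

variable {M : LTS.{uP, uI, u} P I} {N : LTS.{uP, uI, v} P I}

theorem IsPath.append {x y z : M.State} {l l' : List M.Fact} (h : M.IsPath x y l)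
    (h' : M.IsPath y z l') : M.IsPath x z (l ++ l') := by
  induction h with
  | nil x => exact h'
  | cons f hf _ ih => exact .cons f hf (ih h')

theorem IsPath.reverse {x y : M.State} {l : List M.Fact} (h : M.IsPath x y l) :
    M.IsPath y x l.reverse := by
  induction h with
  | nil x => exact .nil x
  | cons f hf _ ih =>
    rw [List.reverse_cons]
    exact ih.append (.cons f (hf.symm) (.nil _))

theorem IsPath.exists_of_append {x z : M.State} {l l' : List M.Fact}
    (h : M.IsPath x z (l ++ l')) : ∃ y, M.IsPath x y l ∧ M.IsPath y z l' := by
  induction l generalizing x with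
  | nil => exact ⟨x, .nil x, h⟩
  | cons f l ih =>
    cases h with
    | cons _ hf h =>
      obtain ⟨y, h₁, h₂⟩ := ih h
      exact ⟨y, .cons f hf h₁, h₂⟩

theorem IsPath.exists_nodup {x z : M.State} {l : List M.Fact} (h : M.IsPath x z l) :
    ∃ l', M.IsPath x z l' ∧ l'.Nodup ∧ l' ⊆ l := by
  induction h with
  | nil x => exact ⟨[], .nil x, List.nodup_nil, fun _ h => h⟩
  | @cons x y z l f hf _ ih =>
    obtain ⟨l', h', hnd, hsub⟩ := ih
    by_cases hmem : f ∈ l'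
    · obtain ⟨l₁, l₂, rfl⟩ := List.append_of_mem hmem
      obtain ⟨c, -, h₂⟩ := h'.exists_of_append
      have hnd₂ : (f :: l₂).Nodup := (List.nodup_append.1 hnd).2.1
      have hsub₂ : l₂ ⊆ f :: l := fun g hg => List.mem_cons_of_mem _ (hsub (by simp [hg]))
      cases h₂ with
      | @cons _ d _ _ _ hf' h₂ =>
        -- The later traversal of `f`, from `c` to `d`, has the same ends as the first. Either it
        -- also starts at `x`, or it ends there and can be dropped too.
        have : c = x ∨ d = x := by
          rcases hf with ⟨hs, ht⟩ | ⟨hs, ht⟩ <;> rcases hf' with ⟨hs', ht'⟩ | ⟨hs', ht'⟩ <;>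
            simp_all
        rcases this with rfl | rfl
        · exact ⟨f :: l₂, .cons f hf' h₂, hnd₂, List.cons_subset.2 ⟨by simp, hsub₂⟩⟩
        · exact ⟨l₂, h₂, hnd₂.of_cons, hsub₂⟩
    · exact ⟨f :: l', .cons f hf h', List.nodup_cons.2 ⟨hmem, hnd⟩,
        List.cons_subset_cons f hsub⟩

/-- Acyclicity says that every fact is a bridge: a path joining its ends without using it would
close up to a cycle after removing repetitions. The empty path shows that loops are excluded. -/
theorem acyclic_iff_forall_mem :
    M.Acyclic ↔ ∀ (f : M.Fact) (l : List M.Fact), M.IsPath f.src f.tgt l → f ∈ l := by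
  constructor
  · intro hM f l h
    by_contra hf
    obtain ⟨l', h', hnd, hsub⟩ := h.exists_nodup
    exact List.cons_ne_nil f l' (hM f.tgt _ (.cons f (.inr ⟨rfl, rfl⟩) h')
      (List.nodup_cons.2 ⟨fun hf' => hf (hsub hf'), hnd⟩))
  · intro hM x l h hnd
    cases h with
    | nil => rfl
    | @cons _ y _ l f hf h =>
      refine absurd ?_ (List.nodup_cons.1 hnd).1
      rcases hf with ⟨rfl, rfl⟩ | ⟨rfl, rfl⟩
      · simpa using hM f _ h.reverse
      · exact hM f _ h

/-- Paths are mapped to paths by maps of states under which every fact is either collapsed or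
related to a fact of the target. -/
theorem IsPath.collapse {e : M.State → N.State} {F : N.Fact → M.Fact → Prop}
    (he : ∀ f : M.Fact, e f.src = e f.tgt ∨
      ∃ f' : N.Fact, f'.src = e f.src ∧ f'.tgt = e f.tgt ∧ F f' f)
    {x y : M.State} {l : List M.Fact} (h : M.IsPath x y l) :
    ∃ l', N.IsPath (e x) (e y) l' ∧ l'.length ≤ l.length ∧ ∀ f' ∈ l', ∃ f ∈ l, F f' f := by
  induction h with
  | nil x => exact ⟨[], .nil _, le_rfl, by simp⟩
  | @cons x y z l f hf _ ih =>
    obtain ⟨l', h', hlen, hl'⟩ := ih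
    have hl'' : ∀ f' ∈ l', ∃ g ∈ f :: l, F f' g := fun f' hf' => by
      obtain ⟨g, hg, hgF⟩ := hl' f' hf'
      exact ⟨g, List.mem_cons_of_mem _ hg, hgF⟩
    rcases he f with heq | ⟨f', hs, ht, hF⟩
    · refine ⟨l', ?_, hlen.trans (Nat.le_succ _), hl''⟩
      have : e x = e y := by rcases hf with ⟨rfl, rfl⟩ | ⟨rfl, rfl⟩ <;> simp [heq]
      rwa [this]
    · refine ⟨f' :: l', .cons f' ?_ h', Nat.succ_le_succ hlen, ?_⟩
      · rcases hf with ⟨rfl, rfl⟩ | ⟨rfl, rfl⟩ <;> simp [hs, ht]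
      · rintro g (_ | ⟨_, hg⟩)
        · exact ⟨f, List.mem_cons_self, hF⟩
        · exact hl'' g hg

theorem IsPath.mem_iff_mem {S : Set M.State} {x y : M.State} {l : List M.Fact}
    (h : M.IsPath x y l) (hl : ∀ f ∈ l, f.src ∈ S ↔ f.tgt ∈ S) : x ∈ S ↔ y ∈ S := by
  induction h with
  | nil x => rfl
  | cons f hf _ ih =>
    refine Iff.trans ?_ (ih fun g hg => hl g (List.mem_cons_of_mem _ hg))
    have := hl f List.mem_cons_self
    rcases hf with ⟨rfl, rfl⟩ | ⟨rfl, rfl⟩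
    · exact this
    · exact this.symm

theorem Acyclic.of_injective {e : M.State → N.State} (he : Function.Injective e)
    (hrel : ∀ i m n, M.rel i m n → N.rel i (e m) (e n)) (hN : N.Acyclic) : M.Acyclic := by
  rw [acyclic_iff_forall_mem] at hN ⊢
  intro f l h
  obtain ⟨l', h', -, hl'⟩ := h.collapse (N := N) (e := e)
    (F := fun f' f => f'.label = f.label ∧ f'.src = e f.src ∧ f'.tgt = e f.tgt)
    fun f => .inr ⟨⟨f.label, e f.src, e f.tgt, hrel _ _ _ f.holds⟩, rfl, rfl, rfl, rfl, rfl⟩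
  obtain ⟨g, hg, hlab, hs, ht⟩ := hl' _ (hN ⟨f.label, e f.src, e f.tgt, hrel _ _ _ f.holds⟩ l' h')
  rwa [Fact.eq_of_eq hlab (he hs) (he ht)]

theorem depth_le_iff {k : ℕ} :
    M.depth ≤ k ↔ ∀ m, ∃ l, M.IsPath M.point m l ∧ l.length ≤ k := by
  refine iSup_le_iff.trans (forall_congr' fun m => ?_)
  constructor
  · intro h
    -- A strict bound is what extracts a path from the infimum; integrality then gives back length
    -- at most `k`.
    have h' : M.stateDepth m < (k + 1 : ℕ) := h.trans_lt (by exact_mod_cast Nat.lt_succ_self k)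
    obtain ⟨l, hl⟩ := iInf_lt_iff.1 h'
    obtain ⟨hp, hl⟩ := iInf_lt_iff.1 hl
    exact ⟨l, hp, Nat.lt_succ_iff.1 (by exact_mod_cast hl)⟩
  · rintro ⟨l, hp, hl⟩
    exact (iInf₂_le l hp).trans (by exact_mod_cast hl)

theorem mem_connectedAcyclic_iff {k : ℕ} :
    M ∈ connectedAcyclic P I k ↔
      Finite M.State ∧ M.Acyclic ∧ ∀ m, ∃ l, M.IsPath M.point m l ∧ l.length ≤ k := by
  rw [← depth_le_iff]
  refine ⟨fun h => ⟨h.1, h.2.2⟩, fun h => ⟨h.1, fun x y => ?_, h.2⟩⟩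
  obtain ⟨l, hl, -⟩ := depth_le_iff.1 h.2.2 x
  obtain ⟨l', hl', -⟩ := depth_le_iff.1 h.2.2 y
  exact ⟨_, hl.reverse.append hl'⟩

end Paths

/-! ### Isomorphisms and grafting -/

/-- Isomorphisms of labeled transition systems. -/
structure Iso (M : LTS.{uP, uI, u} P I) (N : LTS.{uP, uI, v} P I) where
  toEquiv : M.State ≃ N.State
  map_point : toEquiv M.point = N.point
  val_iff : ∀ p m, N.val p (toEquiv m) ↔ M.val p m
  rel_iff : ∀ i m n, N.rel i (toEquiv m) (toEquiv n) ↔ M.rel i m n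

/-- The identity isomorphism. -/
def Iso.refl (M : LTS.{uP, uI, u} P I) : Iso M M :=
  ⟨Equiv.refl _, rfl, fun _ _ => Iff.rfl, fun _ _ _ => Iff.rfl⟩

theorem Iso.mem_connectedAcyclic {M : LTS.{uP, uI, u} P I} {N : LTS.{uP, uI, v} P I}
    (e : Iso M N) {k : ℕ} (hM : M ∈ connectedAcyclic P I k) : N ∈ connectedAcyclic P I k := by
  rw [mem_connectedAcyclic_iff] at hM ⊢
  obtain ⟨hfin, hac, hreach⟩ := hM
  refine ⟨Finite.of_equiv _ e.toEquiv, hac.of_injective e.toEquiv.symm.injective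
    fun i m n h => by simpa [← e.rel_iff] using h, fun m => ?_⟩
  obtain ⟨l, hl, hlen⟩ := hreach (e.toEquiv.symm m)
  obtain ⟨l', hl', hlen', -⟩ := hl.collapse (N := N) (e := e.toEquiv) (F := fun _ _ => True)
    fun f => .inr ⟨⟨f.label, _, _, (e.rel_iff _ _ _).2 f.holds⟩, rfl, rfl, trivial⟩
  rw [e.map_point, Equiv.apply_symm_apply] at hl'
  exact ⟨l', hl', hlen'.trans hlen⟩

/-- Composition with an isomorphism, as a bijection between sets of homomorphisms. -/
def Iso.homEquiv {T : LTS.{uP, uI, u} P I} {T' : LTS.{uP, uI, v} P I} (e : Iso T T')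
    (M : LTS.{uP, uI, w} P I) : Hom T M ≃ Hom T' M where
  toFun h :=
    { toFun := fun s => h.toFun (e.toEquiv.symm s)
      map_point := by rw [← e.map_point, Equiv.symm_apply_apply, h.map_point]
      map_val := fun p m hm => h.map_val _ _ (by rwa [← e.val_iff, Equiv.apply_symm_apply])
      map_rel := fun i m n hmn => h.map_rel _ _ _ (by
        rwa [← e.rel_iff, Equiv.apply_symm_apply, Equiv.apply_symm_apply]) }
  invFun h :=
    { toFun := fun s => h.toFun (e.toEquiv s)
      map_point := by rw [e.map_point, h.map_point]
      map_val := fun p m hm => h.map_val _ _ ((e.val_iff _ _).2 hm)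
      map_rel := fun i m n hmn => h.map_rel _ _ _ ((e.rel_iff _ _ _).2 hmn) }
  left_inv h := by ext; simp
  right_inv h := by ext; simp

/-- The transitions of `graft`. -/
def graftRel (A B : LTS.{uP, uI, u} P I) (j : I × Bool) (i : I) :
    A.State ⊕ B.State → A.State ⊕ B.State → Prop
  | .inl a, .inl a' => A.rel i a a'
  | .inr b, .inr b' => B.rel i b b'
  | .inl a, .inr b => j = (i, true) ∧ a = A.point ∧ b = B.point
  | .inr b, .inl a => j = (i, false) ∧ a = A.point ∧ b = B.point

/-- The disjoint union of `A` and `B` with a new transition between the distinguished states. -/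
def graft (A : LTS.{uP, uI, u} P I) (j : I × Bool) (B : LTS.{uP, uI, u} P I) :
    LTS.{uP, uI, u} P I where
  State := A.State ⊕ B.State
  val p := Sum.elim (A.val p) (B.val p)
  rel := graftRel A B j
  point := .inl A.point

section Graft

variable {A B : LTS.{uP, uI, u} P I} {j : I × Bool}

theorem exists_bridge (A : LTS.{uP, uI, u} P I) (j : I × Bool) (B : LTS.{uP, uI, u} P I) :
    ∃ f : (A.graft j B).Fact, (f.src = .inl A.point ∧ f.tgt = .inr B.point) ∨
      (f.src = .inr B.point ∧ f.tgt = .inl A.point) := by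
  obtain ⟨i, _ | _⟩ := j
  · exact ⟨⟨i, .inr B.point, .inl A.point, rfl, rfl, rfl⟩, .inr ⟨rfl, rfl⟩⟩
  · exact ⟨⟨i, .inl A.point, .inr B.point, rfl, rfl, rfl⟩, .inl ⟨rfl, rfl⟩⟩

theorem graft_collapse_left (f : (A.graft j B).Fact) :
    Sum.elim id (fun _ => A.point) f.src = Sum.elim id (fun _ => A.point) f.tgt ∨
      ∃ f' : A.Fact, f'.src = Sum.elim id (fun _ => A.point) f.src ∧
        f'.tgt = Sum.elim id (fun _ => A.point) f.tgt ∧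
        f'.label = f.label ∧ .inl f'.src = f.src ∧ .inl f'.tgt = f.tgt := by
  obtain ⟨i, x | x, y | y, h⟩ := f
  · exact .inr ⟨⟨i, x, y, h⟩, rfl, rfl, rfl, rfl, rfl⟩
  · exact .inl h.2.1
  · exact .inl h.2.1.symm
  · exact .inl rfl

theorem graft_collapse_right (f : (A.graft j B).Fact) :
    Sum.elim (fun _ => B.point) id f.src = Sum.elim (fun _ => B.point) id f.tgt ∨
      ∃ f' : B.Fact, f'.src = Sum.elim (fun _ => B.point) id f.src ∧
        f'.tgt = Sum.elim (fun _ => B.point) id f.tgt ∧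
        f'.label = f.label ∧ .inr f'.src = f.src ∧ .inr f'.tgt = f.tgt := by
  obtain ⟨i, x | x, y | y, h⟩ := f
  · exact .inl rfl
  · exact .inl h.2.2.symm
  · exact .inl h.2.2
  · exact .inr ⟨⟨i, x, y, h⟩, rfl, rfl, rfl, rfl, rfl⟩

theorem graft_crossing_unique {f g : (A.graft j B).Fact}
    (hf : ¬ (f.src ∈ Set.range Sum.inl ↔ f.tgt ∈ Set.range Sum.inl))
    (hg : ¬ (g.src ∈ Set.range Sum.inl ↔ g.tgt ∈ Set.range Sum.inl)) : f = g := by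
  have key : ∀ f : (A.graft j B).Fact,
      ¬ (f.src ∈ Set.range Sum.inl ↔ f.tgt ∈ Set.range Sum.inl) →
      (j = (f.label, true) ∧ f.src = .inl A.point ∧ f.tgt = .inr B.point) ∨
      (j = (f.label, false) ∧ f.src = .inr B.point ∧ f.tgt = .inl A.point) := by
    rintro ⟨i, x | x, y | y, h⟩ hf
    · exact absurd (iff_of_true ⟨x, rfl⟩ ⟨y, rfl⟩) hf
    · obtain ⟨hj, rfl, rfl⟩ := h
      exact .inl ⟨hj, rfl, rfl⟩
    · obtain ⟨hj, rfl, rfl⟩ := h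
      exact .inr ⟨hj, rfl, rfl⟩
    · exact absurd (iff_of_false (fun ⟨_, h⟩ => Sum.inl_ne_inr h)
        (fun ⟨_, h⟩ => Sum.inl_ne_inr h)) hf
  rcases key f hf with ⟨hj, hs, ht⟩ | ⟨hj, hs, ht⟩ <;>
    rcases key g hg with ⟨hj', hs', ht'⟩ | ⟨hj', hs', ht'⟩
  · exact Fact.eq_of_eq (Prod.ext_iff.1 (hj.symm.trans hj')).1 (hs.trans hs'.symm)
      (ht.trans ht'.symm)
  · exact absurd (Prod.ext_iff.1 (hj.symm.trans hj')).2 (by simp)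
  · exact absurd (Prod.ext_iff.1 (hj.symm.trans hj')).2 (by simp)
  · exact Fact.eq_of_eq (Prod.ext_iff.1 (hj.symm.trans hj')).1 (hs.trans hs'.symm)
      (ht.trans ht'.symm)

/-- For a fact inside one half, contracting the other half to the root turns a path joining its ends
into a path within the half. For the new fact, a path avoiding it can never change sides. -/
theorem Acyclic.graft (hA : A.Acyclic) (hB : B.Acyclic) (j : I × Bool) :
    (A.graft j B).Acyclic := by
  rw [acyclic_iff_forall_mem] at hA hB ⊢
  intro f l h
  by_cases hf : f.src ∈ Set.range Sum.inl ↔ f.tgt ∈ Set.range Sum.inl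
  · obtain ⟨i, x | x, y | y, hr⟩ := f
    · obtain ⟨l', h', -, hl'⟩ := h.collapse graft_collapse_left
      obtain ⟨g, hg, hlab, hs, ht⟩ := hl' ⟨i, x, y, hr⟩ (hA ⟨i, x, y, hr⟩ l' h')
      rwa [← Fact.eq_of_eq (f := ⟨i, _, _, hr⟩) (g := g) hlab hs ht] at hg
    · exact absurd (hf.1 ⟨x, rfl⟩) fun ⟨_, h⟩ => Sum.inl_ne_inr h
    · exact absurd (hf.2 ⟨y, rfl⟩) fun ⟨_, h⟩ => Sum.inl_ne_inr h
    · obtain ⟨l', h', -, hl'⟩ := h.collapse graft_collapse_right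
      obtain ⟨g, hg, hlab, hs, ht⟩ := hl' ⟨i, x, y, hr⟩ (hB ⟨i, x, y, hr⟩ l' h')
      rwa [← Fact.eq_of_eq (f := ⟨i, _, _, hr⟩) (g := g) hlab hs ht] at hg
  · by_contra hmem
    refine hf (h.mem_iff_mem fun g hg => ?_)
    by_contra hg'
    exact hmem (graft_crossing_unique hf hg' ▸ hg)

theorem graft_mem_connectedAcyclic {k k' : ℕ} (hA : A ∈ connectedAcyclic P I k)
    (hB : B ∈ connectedAcyclic P I k') (j : I × Bool) :
    A.graft j B ∈ connectedAcyclic P I (max k (k' + 1)) := by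
  rw [mem_connectedAcyclic_iff] at hA hB ⊢
  obtain ⟨hfin, hac, hreach⟩ := hA
  obtain ⟨hfin', hac', hreach'⟩ := hB
  refine ⟨inferInstanceAs (Finite (A.State ⊕ B.State)), hac.graft hac' j, ?_⟩
  rintro (m | m)
  · obtain ⟨l, hl, hlen⟩ := hreach m
    obtain ⟨l', hl', hlen', -⟩ := hl.collapse (N := A.graft j B) (e := Sum.inl)
      (F := fun _ _ => True) fun f => .inr ⟨⟨f.label, .inl f.src, .inl f.tgt, f.holds⟩, rfl, rfl, trivial⟩
    exact ⟨l', hl', by omega⟩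
  · obtain ⟨l, hl, hlen⟩ := hreach' m
    obtain ⟨l', hl', hlen', -⟩ := hl.collapse (N := A.graft j B) (e := Sum.inr)
      (F := fun _ _ => True) fun f => .inr ⟨⟨f.label, .inr f.src, .inr f.tgt, f.holds⟩, rfl, rfl, trivial⟩
    obtain ⟨f, hf⟩ := exists_bridge A j B
    exact ⟨f :: l', .cons f hf hl', by simp only [List.length_cons]; omega⟩

/-- Follow the path until it first enters `B`, necessarily at the root, and contract the rest onto
`B`. The crossing fact is lost, which saves one in length. -/
theorem IsPath.graft_right {x : (A.graft j B).State} {b : B.State} {l : List (A.graft j B).Fact}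
    (h : (A.graft j B).IsPath x (.inr b) l) (hx : x ∈ Set.range Sum.inl) :
    ∃ l', B.IsPath B.point b l' ∧ l'.length + 1 ≤ l.length := by
  generalize hz : (Sum.inr b : (A.graft j B).State) = z at h
  induction h with
  | nil x =>
    subst hz
    exact absurd hx fun ⟨_, h⟩ => Sum.inl_ne_inr h
  | @cons x y z l f hf h ih =>
    subst hz
    obtain ⟨a, rfl⟩ := hx
    rcases y with a' | b'
    · obtain ⟨l', h', hlen⟩ := ih ⟨a', rfl⟩ rfl
      exact ⟨l', h', hlen.trans (Nat.le_succ _)⟩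
    · obtain ⟨l', h', hlen, -⟩ := h.collapse graft_collapse_right
      obtain rfl : b' = B.point := by
        obtain ⟨i, s, t, hr⟩ := f
        rcases hf with ⟨hs, ht⟩ | ⟨hs, ht⟩
        · obtain rfl : s = _ := hs
          obtain rfl : t = _ := ht
          exact hr.2.2
        · obtain rfl : s = _ := hs
          obtain rfl : t = _ := ht
          exact hr.2.2
      exact ⟨l', h', Nat.succ_le_succ hlen⟩

theorem connectedAcyclic_of_graft {k : ℕ} (h : A.graft j B ∈ connectedAcyclic P I k) :
    A ∈ connectedAcyclic P I k ∧ ∃ k', k = k' + 1 ∧ B ∈ connectedAcyclic P I k' := by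
  simp only [mem_connectedAcyclic_iff] at h ⊢
  obtain ⟨hfin, hac, hreach⟩ := h
  have hfin : Finite (A.State ⊕ B.State) := hfin
  -- Truncation in `k - 1` does no harm: the root of `B` is at distance at least 1, so `k` is
  -- positive.
  refine ⟨⟨.of_injective (Sum.inl : _ → A.State ⊕ B.State) Sum.inl_injective,
    hac.of_injective (e := Sum.inl) Sum.inl_injective fun _ _ _ h => h, fun m => ?_⟩, k - 1, ?_,
    .of_injective (Sum.inr : _ → A.State ⊕ B.State) Sum.inr_injective,
    hac.of_injective (e := Sum.inr) Sum.inr_injective fun _ _ _ h => h, fun m => ?_⟩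
  · obtain ⟨l, hl, hlen⟩ := hreach (.inl m)
    obtain ⟨l', hl', hlen', -⟩ := hl.collapse graft_collapse_left
    exact ⟨l', hl', hlen'.trans hlen⟩
  · obtain ⟨l, hl, hlen⟩ := hreach (.inr B.point)
    obtain ⟨l', hl', hlen'⟩ := hl.graft_right ⟨A.point, rfl⟩
    omega
  · obtain ⟨l, hl, hlen⟩ := hreach (.inr m)
    obtain ⟨l', hl', hlen'⟩ := hl.graft_right ⟨A.point, rfl⟩
    exact ⟨l', hl', by omega⟩

/-- A homomorphism from `A.graft j B` is a pair of homomorphisms from `A` and `B` such that the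
images of the distinguished states are adjacent. -/
def homGraftEquiv (A : LTS.{uP, uI, u} P I) (j : I × Bool) (B : LTS.{uP, uI, u} P I)
    (M : LTS.{uP, uI, v} P I) (m : M.State) :
    Hom (A.graft j B) (M.withPoint m) ≃
      Hom A (M.withPoint m) × Σ n : M.step j m, Hom B (M.withPoint n.1) where
  toFun h :=
    ⟨{ toFun := fun a => h.toFun (.inl a)
       map_point := h.map_point
       map_val := fun p a ha => h.map_val p (.inl a) ha
       map_rel := fun i a a' ha => h.map_rel i (.inl a) (.inl a') ha },
     ⟨h.toFun (.inr B.point), by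
        have hp : h.toFun (.inl A.point) = m := h.map_point
        obtain ⟨i, _ | _⟩ := j
        · have := h.map_rel i (.inr B.point) (.inl A.point) ⟨rfl, rfl, rfl⟩
          rwa [hp] at this
        · have := h.map_rel i (.inl A.point) (.inr B.point) ⟨rfl, rfl, rfl⟩
          rwa [hp] at this⟩,
      { toFun := fun b => h.toFun (.inr b)
        map_point := rfl
        map_val := fun p b hb => h.map_val p (.inr b) hb
        map_rel := fun i b b' hb => h.map_rel i (.inr b) (.inr b') hb }⟩
  invFun g :=
    { toFun := Sum.elim g.1.toFun g.2.2.toFun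
      map_point := g.1.map_point
      map_val := by
        rintro p (a | b) h
        · exact g.1.map_val p a h
        · exact g.2.2.map_val p b h
      map_rel := by
        obtain ⟨g, ⟨n, hn⟩, g'⟩ := g
        have hp : g.toFun A.point = m := g.map_point
        have hp' : g'.toFun B.point = n := g'.map_point
        rintro i (a | b) (a' | b') h
        · exact g.map_rel i a a' h
        · obtain ⟨rfl, rfl, rfl⟩ := h
          change M.rel i (g.toFun A.point) (g'.toFun B.point)
          rw [hp, hp']
          exact hn
        · obtain ⟨rfl, rfl, rfl⟩ := h
          change M.rel i (g'.toFun B.point) (g.toFun A.point)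
          rw [hp, hp']
          exact hn
        · exact g'.map_rel i b b' h }
  left_inv h := by
    apply Hom.ext
    funext s
    rcases s with a | b <;> rfl
  right_inv := by
    -- With `n` a variable, the equation `g B.point = n` can be substituted, which avoids transport
    -- in the dependent pair.
    have key : ∀ (g : B.State → M.State) (n : M.State) (hn : n ∈ M.step j m)
        (hp : g B.point = n) (hv : ∀ p b, B.val p b → M.val p (g b))
        (hr : ∀ i b b', B.rel i b b' → M.rel i (g b) (g b')),
        (⟨⟨g B.point, hp ▸ hn⟩, ⟨g, rfl, hv, hr⟩⟩ : Σ n : M.step j m, Hom B (M.withPoint n.1)) =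
          ⟨⟨n, hn⟩, ⟨g, hp, hv, hr⟩⟩ := by
      rintro g _ hn rfl hv hr
      rfl
    rintro ⟨g, ⟨n, hn⟩, ⟨g', hp, hv, hr⟩⟩
    exact Prod.ext rfl (key g' n hn hp hv hr)

end Graft

/-! ### Acyclic systems as trees -/

/-- `T.Represents t`: the system `T` has the shape of the tree `t`. -/
inductive Represents : LTS.{uP, uI, w} P I → Tree P I → Prop
  | leaf (T : LTS.{uP, uI, w} P I) (h : ∀ z, z = T.point) (hr : ∀ i, ¬ T.rel i T.point T.point)
      (S : Set P) (hS : ∀ p, T.val p T.point ↔ p ∈ S) : Represents T (.leaf S)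
  | graft {T A B : LTS.{uP, uI, w} P I} {t t' : Tree P I} {j : I × Bool} (hA : Represents A t)
      (hB : Represents B t') (e : Iso T (A.graft j B)) : Represents T (.graft t j t')

theorem Represents.finite_hom_and_homCount {T : LTS.{uP, uI, w} P I} {t : Tree P I}
    (hT : T.Represents t) {M : LTS.{uP, uI, u} P I} (hM : M.DegreeFinite) (m : M.State) :
    Finite (Hom T (M.withPoint m)) ∧ homCount T (M.withPoint m) = t.count M m := by
  induction hT generalizing m with
  | leaf T h hr S hS =>
    have hsub : Subsingleton (Hom T (M.withPoint m)) := ⟨fun f g => Hom.ext <| funext fun z => by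
      rw [h z, f.map_point, g.map_point]⟩
    refine ⟨inferInstance, ?_⟩
    by_cases hm : ∀ p ∈ S, M.val p m
    · rw [Tree.count, if_pos hm]
      have f : Hom T (M.withPoint m) :=
        ⟨fun _ => m, rfl, fun p z hz => hm p ((hS p).1 (h z ▸ hz)),
          fun i z z' hz => absurd hz (by rw [h z, h z']; exact hr i)⟩
      exact Nat.card_eq_one_iff_unique.2 ⟨hsub, ⟨f⟩⟩
    · rw [Tree.count, if_neg hm]
      have : IsEmpty (Hom T (M.withPoint m)) := ⟨fun f => hm fun p hp => by
        have := f.map_val p _ ((hS p).2 hp)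
        rwa [f.map_point] at this⟩
      exact Nat.card_of_isEmpty
  | @graft T A B t t' j _ _ e ih ih' =>
    have hA := (ih m).1
    have hB := fun n => (ih' n).1
    have hs := (hM.finite_step j m).to_subtype
    let eq := (e.homEquiv (M.withPoint m)).trans (homGraftEquiv A j B M m)
    refine ⟨Finite.of_equiv _ eq.symm, ?_⟩
    have := Fintype.ofFinite (M.step j m)
    rw [homCount, Nat.card_congr eq, Nat.card_prod, Nat.card_sigma, Tree.count, ← (ih m).2,
      ← finsum_set_coe_eq_finsum_mem, finsum_eq_sum_of_fintype]
    congr 1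
    exact Finset.sum_congr rfl fun n _ => (ih' n.1).2

theorem exists_represents (t : Tree P I) :
    ∃ T ∈ connectedAcyclic.{uP, uI, w} P I t.depth, T.Represents t := by
  induction t with
  | leaf S =>
    let T : LTS.{uP, uI, w} P I := ⟨PUnit, fun p _ => p ∈ S, fun _ _ _ => False, ⟨⟩⟩
    refine ⟨T, mem_connectedAcyclic_iff.2 ⟨inferInstanceAs (Finite PUnit), ?_, fun m =>
      ⟨[], .nil _, le_rfl⟩⟩, .leaf T (fun _ => rfl) (fun _ h => h) S fun _ => Iff.rfl⟩
    exact acyclic_iff_forall_mem.2 fun f => f.holds.elim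
  | graft t j t' ih ih' =>
    obtain ⟨A, hA, hAt⟩ := ih
    obtain ⟨B, hB, hBt⟩ := ih'
    exact ⟨A.graft j B, graft_mem_connectedAcyclic hA hB j, .graft hAt hBt (Iso.refl _)⟩

/-- The subsystem of `T` with states `S` and distinguished state `s`. -/
def restrict (T : LTS.{uP, uI, w} P I) (S : Set T.State) (s : S) : LTS.{uP, uI, w} P I where
  State := S
  val p m := T.val p m
  rel i m n := T.rel i m n
  point := s

/-- Splitting an acyclic system along a transition at the distinguished state. -/
theorem exists_iso_graft {T : LTS.{uP, uI, w} P I} (hT : T.Acyclic) {y : T.State} (f : T.Fact)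
    (hf : (f.src = T.point ∧ f.tgt = y) ∨ (f.src = y ∧ f.tgt = T.point)) :
    ∃ (A B : LTS.{uP, uI, w} P I) (j : I × Bool), Nonempty (Iso T (A.graft j B)) := by
  classical
  rw [acyclic_iff_forall_mem] at hT
  -- `S` is the component of the distinguished state after deleting `f`. Since `f` is a bridge, `y`
  -- lies outside `S`, and `f` is the only fact between `S` and its complement.
  let S : Set T.State := {z | ∃ l, T.IsPath T.point z l ∧ f ∉ l}
  have hp : T.point ∈ S := ⟨[], .nil _, by simp⟩
  have hy : y ∉ S := by
    rintro ⟨l, hl, hfl⟩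
    rcases hf with ⟨hs, ht⟩ | ⟨hs, ht⟩
    · rw [← hs, ← ht] at hl
      exact hfl (hT f l hl)
    · rw [← hs, ← ht] at hl
      exact hfl (by simpa using hT f _ hl.reverse)
  have hS : ∀ g : T.Fact, g ≠ f → (g.src ∈ S ↔ g.tgt ∈ S) := by
    refine fun g hg => ⟨?_, ?_⟩
    · rintro ⟨l, hl, hfl⟩
      exact ⟨l ++ [g], hl.append (.cons g (.inl ⟨rfl, rfl⟩) (.nil _)), by simp [hfl, hg.symm]⟩
    · rintro ⟨l, hl, hfl⟩
      exact ⟨l ++ [g], hl.append (.cons g (.inr ⟨rfl, rfl⟩) (.nil _)), by simp [hfl, hg.symm]⟩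
  have hcross : ∀ g : T.Fact, ¬ (g.src ∈ S ↔ g.tgt ∈ S) → g = f :=
    fun g hg => by_contra fun h => hg (hS g h)
  have hj : ∃ j : I × Bool, (j = (f.label, true) ∧ f.src = T.point ∧ f.tgt = y) ∨
      (j = (f.label, false) ∧ f.src = y ∧ f.tgt = T.point) := by
    rcases hf with h | h
    · exact ⟨_, .inl ⟨rfl, h⟩⟩
    · exact ⟨_, .inr ⟨rfl, h⟩⟩
  obtain ⟨j, hj⟩ := hj
  have hout : ∀ i (a b : T.State), a ∈ S → b ∉ S →
      ((j = (i, true) ∧ a = T.point ∧ b = y) ↔ T.rel i a b) := by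
    intro i a b ha hb
    constructor
    · rintro ⟨rfl, rfl, rfl⟩
      rcases hj with ⟨h, hs, ht⟩ | ⟨h, -⟩
      · obtain rfl : i = f.label := congrArg Prod.fst h
        exact hs ▸ ht ▸ f.holds
      · exact absurd (congrArg Prod.snd h) (by simp)
    · intro h
      obtain rfl := hcross ⟨i, a, b, h⟩ fun hiff => hb (hiff.1 ha)
      rcases hj with hj | ⟨-, h, -⟩
      · exact hj
      · obtain rfl : a = y := h
        exact absurd ha hy
  have hin : ∀ i (a b : T.State), a ∈ S → b ∉ S →
      ((j = (i, false) ∧ a = T.point ∧ b = y) ↔ T.rel i b a) := by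
    intro i a b ha hb
    constructor
    · rintro ⟨rfl, rfl, rfl⟩
      rcases hj with ⟨h, -⟩ | ⟨h, hs, ht⟩
      · exact absurd (congrArg Prod.snd h) (by simp)
      · obtain rfl : i = f.label := congrArg Prod.fst h
        exact hs ▸ ht ▸ f.holds
    · intro h
      obtain rfl := hcross ⟨i, b, a, h⟩ fun hiff => hb (hiff.2 ha)
      rcases hj with ⟨-, -, h⟩ | ⟨h, h', h''⟩
      · obtain rfl : a = y := h
        exact absurd ha hy
      · exact ⟨h, h'', h'⟩
  let e : S ⊕ (Sᶜ : Set T.State) ≃ T.State := Equiv.Set.sumCompl S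
  let R := (T.restrict S ⟨_, hp⟩).graft j (T.restrict Sᶜ ⟨_, hy⟩)
  have hval : ∀ p (x : S ⊕ (Sᶜ : Set T.State)), R.val p x ↔ T.val p (e x) := by
    rintro p (x | x) <;> rfl
  have hrel : ∀ i (x z : S ⊕ (Sᶜ : Set T.State)), R.rel i x z ↔ T.rel i (e x) (e z) := by
    rintro i (x | x) (z | z)
    · rfl
    · refine Iff.trans ?_ (hout i x z x.2 z.2)
      exact and_congr_right fun _ => and_congr Subtype.ext_iff Subtype.ext_iff
    · refine Iff.trans ?_ (hin i z x z.2 x.2)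
      exact and_congr_right fun _ => and_congr Subtype.ext_iff Subtype.ext_iff
    · rfl
  refine ⟨_, _, j, ⟨(⟨e.symm, ?_, ?_, ?_⟩ : Iso T R)⟩⟩
  · exact e.symm_apply_eq.2 rfl
  · exact fun p m => (hval p (e.symm m)).trans (iff_of_eq (congrArg _ (e.apply_symm_apply m)))
  · exact fun i m n => (hrel i (e.symm m) (e.symm n)).trans
      (iff_of_eq (congrArg₂ _ (e.apply_symm_apply m) (e.apply_symm_apply n)))

theorem exists_tree_represents {k : ℕ} {T : LTS.{uP, uI, w} P I}
    (hT : T ∈ connectedAcyclic P I k) : ∃ t : Tree P I, t.depth ≤ k ∧ T.Represents t := by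
  induction hc : Nat.card T.State using Nat.strong_induction_on generalizing T k with
  | _ c ih =>
    subst hc
    obtain ⟨hfin, hac, hreach⟩ := mem_connectedAcyclic_iff.1 hT
    by_cases hf : ∃ f : T.Fact, f.src = T.point ∨ f.tgt = T.point
    · obtain ⟨A, B, j, ⟨e⟩⟩ : ∃ (A B : LTS.{uP, uI, w} P I) (j : I × Bool),
          Nonempty (Iso T (A.graft j B)) := by
        obtain ⟨f, hf | hf⟩ := hf
        · exact exists_iso_graft hac f (.inl ⟨hf, rfl⟩)
        · exact exists_iso_graft hac f (.inr ⟨rfl, hf⟩)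
      -- Both halves inherit finiteness, connectedness and acyclicity from the graft, the second
      -- with depth bound one smaller; each is nonempty, so both have fewer states than `T`.
      obtain ⟨hA, k, rfl, hB⟩ := connectedAcyclic_of_graft (e.mem_connectedAcyclic hT)
      have hfA : Finite A.State := hA.1
      have hfB : Finite B.State := hB.1
      have hcard : Nat.card T.State = Nat.card A.State + Nat.card B.State :=
        (Nat.card_congr e.toEquiv).trans Nat.card_sum
      have hposA : 0 < Nat.card A.State := Nat.card_pos_iff.2 ⟨⟨A.point⟩, hfA⟩
      have hposB : 0 < Nat.card B.State := Nat.card_pos_iff.2 ⟨⟨B.point⟩, hfB⟩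
      obtain ⟨t, ht, hAt⟩ := ih _ (by omega) hA rfl
      obtain ⟨t', ht', hBt⟩ := ih _ (by omega) hB rfl
      exact ⟨.graft t j t', max_le ht (Nat.succ_le_succ ht'), .graft hAt hBt e⟩
    -- No fact touches the distinguished state, so by reachability it is the only state.
    · push Not at hf
      refine ⟨.leaf {p | T.val p T.point}, Nat.zero_le k, .leaf T (fun z => ?_)
        (fun i h => (hf ⟨i, _, _, h⟩).1 rfl) _ fun p => Iff.rfl⟩
      obtain ⟨l, hl, -⟩ := hreach z
      cases hl with
      | nil => rfl
      | cons f h _ => exact (h.elim (fun h => (hf f).1 h.1) fun h => (hf f).2 h.2).elim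

theorem leftProfile_eq_iff {M : LTS.{uP, uI, u} P I} {N : LTS.{uP, uI, v} P I}
    (hM : M.DegreeFinite) (hN : N.DegreeFinite) (k : ℕ) :
    leftProfile (connectedAcyclic.{uP, uI, w} P I k) M =
        leftProfile (connectedAcyclic.{uP, uI, w} P I k) N ↔
      ∀ t : Tree P I, t.depth ≤ k → t.count M M.point = t.count N N.point := by
  constructor
  · intro h t ht
    obtain ⟨T, hT, hTt⟩ := exists_represents.{uP, uI, w} t
    have hTk : T ∈ connectedAcyclic P I k :=
      ⟨hT.1, hT.2.1, hT.2.2.1, hT.2.2.2.trans (by exact_mod_cast ht)⟩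
    rw [← (hTt.finite_hom_and_homCount hM M.point).2, ← (hTt.finite_hom_and_homCount hN N.point).2]
    exact congrFun h ⟨T, hTk⟩
  · intro h
    funext ⟨T, hT⟩
    obtain ⟨t, ht, hTt⟩ := exists_tree_represents hT
    exact (hTt.finite_hom_and_homCount hM M.point).2.trans
      ((h t ht).trans (hTt.finite_hom_and_homCount hN N.point).2.symm)

end LTS

end ModalHom

/-- The left profiles restricted to finite connected acyclic systems of depth at most `k` are
well defined (all the sets of homomorphisms are finite), and they agree exactly when the two
systems are equivalent in graded modal logic with graded backward modalities up to depth `k`. -/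
theorem mainTheorem5 {P : Type uP} {I : Type uI} [Finite P] [Finite I]
    (M : ModalHom.LTS.{uP, uI, u} P I) (N : ModalHom.LTS.{uP, uI, v} P I)
    (hM : M.DegreeFinite) (hN : N.DegreeFinite) (k : ℕ) :
    (∀ T ∈ ModalHom.LTS.connectedAcyclic.{uP, uI, w} P I k,
      Finite (ModalHom.LTS.Hom T M) ∧ Finite (ModalHom.LTS.Hom T N)) ∧
    (ModalHom.LTS.leftProfile (ModalHom.LTS.connectedAcyclic.{uP, uI, w} P I k) M =
        ModalHom.LTS.leftProfile (ModalHom.LTS.connectedAcyclic.{uP, uI, w} P I k) N ↔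
      ModalHom.LTS.ModalEquiv k M N) := by
  refine ⟨fun T hT => ?_, (ModalHom.LTS.leftProfile_eq_iff hM hN k).trans
    (ModalHom.forall_count_eq_iff_modalEquiv hM hN k)⟩
  obtain ⟨t, -, hTt⟩ := ModalHom.LTS.exists_tree_represents hT
  -- `M.withPoint M.point` is `M` by structure eta, and likewise for `N`.
  exact ⟨(hTt.finite_hom_and_homCount hM M.point).1, (hTt.finite_hom_and_homCount hN N.point).1⟩
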